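/- Let $s>0$ and let $\mathcal P=\mathbb R[S_1,S_2,S_3]/(S_1^2+S_2^2+S_3^2-s^2)$ be the algebra of polynomials on the sphere of radius $s$, with the Poisson bracket $\{f,g\}=\sum_{i,j,k=1}^{3}\epsilon_{ijk}S_i\frac{\partial f}{\partial S_j}\frac{\partial g}{\partial S_k}$. Let $\mathcal P^1\subset\mathcal P$ be the Poisson subalgebra of elements of degree at most one (that is, having a representative of degree at most one), let $\mathcal O\subset\mathcal P$ be the Poisson subalgebra of odd polynomials (those with a representative all of whose terms have odd degree), and let $\tilde{\mathcal O}=\mathcal O\oplus\mathbb R\supset\mathcal P^1$. (A Poisson subalgebra is a real subspace closed under the Poisson bracket.) An admissible quantization of $(\tilde{\mathcal O},\mathcal P^1)$ is a real-linear map $\mathcal Q$ from $\tilde{\mathcal O}$ to the bounded self-adjoint operators on a complex Hilbert space $H$ such that $\mathcal Q(\{f,g\})=-\mathrm i\,[\mathcal Q(f),\mathcal Q(g)]$ for all $f,g\in\tilde{\mathcal O}$, $\mathcal Q(1)=I$, and $\mathcal Q(\mathcal P^1)$ acts irreducibly, that is, $H\neq 0$ and the only closed subspaces of $H$ invariant under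 all $\mathcal Q(f)$, $f\in\mathcal P^1$, are $0$ and $H$. If $\mathcal Q$ is an admissible quantization of $(\tilde{\mathcal O},\mathcal P^1)$, then there are real constants $a,c$ such that $$\mathcal Q(S_i^3)=a\,\mathcal Q(S_i)^3+c\,\mathcal Q(S_i)\qquad\text{for } i=1,2,3,$$ $$\mathcal Q(S_iS_\ell S_i)=a\,\mathcal Q(S_i)\mathcal Q(S_\ell)\mathcal Q(S_i)+\tfrac13(a+c)\,\mathcal Q(S_\ell)\qquad\text{for all } i\neq\ell,$$ $$\mathcal Q(S_1S_2S_3)=a\,\mathcal Q(S_1)\mathcal Q(S_2)\mathcal Q(S_3)+\frac{a}{2\mathrm i}\bigl(\mathcal Q(S_1)^2-\mathcal Q(S_2)^2+\mathcal Q(S_3)^2\bigr).$$ -/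

import Mathlib

namespace SpinSphere

open MvPolynomial

/-! ### Polynomials in the spin components on the sphere of radius `s` -/

/-- Real polynomials in the three indeterminates `S₁, S₂, S₃` (indexed by `0, 1, 2`). -/
abbrev Poly : Type := MvPolynomial (Fin 3) ℝ

/-- The bracket `{f, g} = ∑ ε_{ijk} S_i (∂f/∂S_j) (∂g/∂S_k)` of polynomials on `ℝ³`, with the sum
over the six nonzero values of the Levi-Civita symbol written out. -/
noncomputable def polyBracket (f g : Poly) : Poly :=
  X 0 * (pderiv 1 f * pderiv 2 g - pderiv 2 f * pderiv 1 g)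
    + X 1 * (pderiv 2 f * pderiv 0 g - pderiv 0 f * pderiv 2 g)
    + X 2 * (pderiv 0 f * pderiv 1 g - pderiv 1 f * pderiv 0 g)

/-- The ideal generated by `S₁² + S₂² + S₃² - s²`. -/
noncomputable def sphereIdeal (s : ℝ) : Ideal Poly :=
  Ideal.span {X 0 ^ 2 + X 1 ^ 2 + X 2 ^ 2 - C (s ^ 2)}

/-- The algebra `𝒫` of polynomials in the spin components modulo `S₁² + S₂² + S₃² = s²`. -/
abbrev SpherePoly (s : ℝ) : Type := Poly ⧸ sphereIdeal s

/-- The class in `𝒫` of a polynomial, as a real-linear map. -/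
noncomputable def toSphere (s : ℝ) : Poly →ₗ[ℝ] SpherePoly s :=
  (Ideal.Quotient.mkₐ ℝ (sphereIdeal s)).toLinearMap

/-- The spin component `S_i` as an element of `𝒫`. -/
noncomputable def spin (s : ℝ) (i : Fin 3) : SpherePoly s :=
  Ideal.Quotient.mk (sphereIdeal s) (X i)

theorem polyBracket_swap (f g : Poly) : polyBracket f g = -polyBracket g f := by
  unfold polyBracket; ring

theorem polyBracket_add_left (f g h : Poly) :
    polyBracket (f + g) h = polyBracket f h + polyBracket g h := by
  simp only [polyBracket, map_add]; ring

theorem polyBracket_add_right (f g h : Poly) :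
    polyBracket h (f + g) = polyBracket h f + polyBracket h g := by
  simp only [polyBracket, map_add]; ring

theorem polyBracket_C_left (r : ℝ) (g : Poly) : polyBracket (C r) g = 0 := by
  simp [polyBracket]

theorem polyBracket_C_right (r : ℝ) (g : Poly) : polyBracket g (C r) = 0 := by
  simp [polyBracket]

theorem polyBracket_mem_left (s : ℝ) {f : Poly} (hf : f ∈ sphereIdeal s) (g : Poly) :
    polyBracket f g ∈ sphereIdeal s := by
  obtain ⟨h, rfl⟩ := Ideal.mem_span_singleton'.1 hf
  refine Ideal.mem_span_singleton'.2 ⟨polyBracket h g, ?_⟩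
  have h01 : (0 : Fin 3) ≠ 1 := by decide
  have h02 : (0 : Fin 3) ≠ 2 := by decide
  have h12 : (1 : Fin 3) ≠ 2 := by decide
  simp only [polyBracket, Derivation.leibniz, Derivation.leibniz_pow, map_add, map_sub, pderiv_C,
    pderiv_X_self, pderiv_X_of_ne h01, pderiv_X_of_ne h02, pderiv_X_of_ne h12,
    pderiv_X_of_ne h01.symm, pderiv_X_of_ne h02.symm, pderiv_X_of_ne h12.symm, smul_eq_mul,
    nsmul_eq_mul]
  push_cast
  ring

theorem polyBracket_mem_right (s : ℝ) {f : Poly} (hf : f ∈ sphereIdeal s) (g : Poly) :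
    polyBracket g f ∈ sphereIdeal s := by
  rw [polyBracket_swap]
  exact neg_mem (polyBracket_mem_left s hf g)

theorem toSphere_polyBracket_congr (s : ℝ) {f f' g g' : Poly}
    (hf : toSphere s f = toSphere s f') (hg : toSphere s g = toSphere s g') :
    toSphere s (polyBracket f g) = toSphere s (polyBracket f' g') := by
  have hf' : f - f' ∈ sphereIdeal s := Ideal.Quotient.eq.1 hf
  have hg' : g - g' ∈ sphereIdeal s := Ideal.Quotient.eq.1 hg
  refine Ideal.Quotient.eq.2 ?_
  have e : polyBracket f g - polyBracket f' g'
      = polyBracket (f - f') g + polyBracket f' (g - g') := by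
    simp only [polyBracket, map_sub]; ring
  rw [e]
  exact add_mem (polyBracket_mem_left s hf' g) (polyBracket_mem_right s hg' f')

/-- The Poisson bracket on `𝒫`, induced by the bracket of representatives. -/
noncomputable def poissonBracket (s : ℝ) (p q : SpherePoly s) : SpherePoly s :=
  Quotient.liftOn₂ p q (fun f g => toSphere s (polyBracket f g))
    (fun _ _ _ _ hf hg => toSphere_polyBracket_congr s (Quotient.sound hf) (Quotient.sound hg))

theorem poissonBracket_toSphere (s : ℝ) (f g : Poly) :
    poissonBracket s (toSphere s f) (toSphere s g) = toSphere s (polyBracket f g) := rfl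

/-! ### Poisson subalgebras -/

/-- A Poisson subalgebra of `𝒫`: a real subspace closed under the Poisson bracket. -/
structure PoissonSubalgebra (s : ℝ) extends Submodule ℝ (SpherePoly s) where
  bracket_mem' : ∀ p q : SpherePoly s, p ∈ carrier → q ∈ carrier → poissonBracket s p q ∈ carrier

/-- The polynomials all of whose terms are of odd degree. -/
def oddPoly : Submodule ℝ Poly where
  carrier := {f | ∀ d : Fin 3 →₀ ℕ, coeff d f ≠ 0 → Odd d.degree}
  zero_mem' := fun d hd => absurd (coeff_zero d) hd
  add_mem' := by
    intro f g hf hg d hd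
    by_cases h : coeff d f = 0
    · refine hg d fun h' => hd ?_
      rw [coeff_add, h, h', add_zero]
    · exact hf d h
  smul_mem' := by
    intro r f hf d hd
    refine hf d fun h => hd ?_
    rw [coeff_smul, h, smul_zero]

/-- The subspace `𝒫ᵏ` of elements of `𝒫` with a representative of degree at most `k`. -/
noncomputable def degreeLE (s : ℝ) (k : ℕ) : Submodule ℝ (SpherePoly s) :=
  (restrictTotalDegree (Fin 3) ℝ k).map (toSphere s)

/-- The subspace `𝒪` of odd elements of `𝒫`. -/
noncomputable def oddPart (s : ℝ) : Submodule ℝ (SpherePoly s) :=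
  oddPoly.map (toSphere s)

/-- The subspace `𝒪 + ℝ` of `𝒫`. -/
noncomputable def oddPlusConstSubmodule (s : ℝ) : Submodule ℝ (SpherePoly s) :=
  oddPart s ⊔ Submodule.span ℝ {1}

theorem mem_oddPoly_iff (f : Poly) :
    f ∈ oddPoly ↔ IsWeightedHomogeneous (fun _ : Fin 3 => (1 : ZMod 2)) f 1 := by
  have key : ∀ d : Fin 3 →₀ ℕ,
      Finsupp.weight (fun _ : Fin 3 => (1 : ZMod 2)) d = (d.degree : ZMod 2) := by
    intro d
    rw [Finsupp.weight_apply, Finsupp.degree_eq_sum, Finsupp.sum_fintype _ _ (by simp)]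
    simp
  constructor
  · intro hf d hd
    rw [key]
    exact (ZMod.natCast_eq_one_iff_odd).2 (hf d hd)
  · intro hf d hd
    have := hf hd
    rw [key] at this
    exact (ZMod.natCast_eq_one_iff_odd).1 this

theorem polyBracket_mem_oddPoly {f g : Poly} (hf : f ∈ oddPoly) (hg : g ∈ oddPoly) :
    polyBracket f g ∈ oddPoly := by
  rw [mem_oddPoly_iff] at *
  have hd : ∀ {h : Poly} (i : Fin 3),
      IsWeightedHomogeneous (fun _ : Fin 3 => (1 : ZMod 2)) h 1 →
      IsWeightedHomogeneous (fun _ : Fin 3 => (1 : ZMod 2)) (pderiv i h) 0 :=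
    fun i hh => hh.pderiv (by simp)
  have hm : ∀ i j k : Fin 3, IsWeightedHomogeneous (fun _ : Fin 3 => (1 : ZMod 2))
      (X i * (pderiv j f * pderiv k g - pderiv k f * pderiv j g)) 1 := by
    intro i j k
    have h1 := ((hd j hf).mul (hd k hg)).sub ((hd k hf).mul (hd j hg))
    have h2 := (isWeightedHomogeneous_X ℝ (fun _ : Fin 3 => (1 : ZMod 2)) i).mul h1
    simpa using h2
  exact ((hm 0 1 2).add (hm 1 2 0)).add (hm 2 0 1)

theorem mem_oddPlusConst_iff (s : ℝ) (p : SpherePoly s) :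
    p ∈ oddPlusConstSubmodule s ↔ ∃ f ∈ oddPoly, ∃ r : ℝ, toSphere s (f + C r) = p := by
  have hC : ∀ r : ℝ, toSphere s (C r) = r • (1 : SpherePoly s) := by
    intro r
    rw [show (C r : Poly) = r • 1 by rw [smul_eq_C_mul, mul_one], map_smul]
    rfl
  simp only [oddPlusConstSubmodule, Submodule.mem_sup, oddPart, Submodule.mem_map,
    Submodule.mem_span_singleton, map_add, hC]
  constructor
  · rintro ⟨_, ⟨f, hf, rfl⟩, _, ⟨r, rfl⟩, h⟩
    exact ⟨f, hf, r, h⟩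
  · rintro ⟨f, hf, r, h⟩
    exact ⟨_, ⟨f, hf, rfl⟩, _, ⟨r, rfl⟩, h⟩

/-- The Poisson subalgebra `𝒪̃ = 𝒪 ⊕ ℝ` of `𝒫`. -/
noncomputable def oddPlusConst (s : ℝ) : PoissonSubalgebra s where
  toSubmodule := oddPlusConstSubmodule s
  bracket_mem' := by
    intro p q hp hq
    obtain ⟨f, hf, r, rfl⟩ := (mem_oddPlusConst_iff s p).1 hp
    obtain ⟨g, hg, t, rfl⟩ := (mem_oddPlusConst_iff s q).1 hq
    refine (mem_oddPlusConst_iff s _).2 ⟨_, polyBracket_mem_oddPoly hf hg, 0, ?_⟩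
    rw [poissonBracket_toSphere]
    simp [polyBracket_add_left, polyBracket_add_right, polyBracket_C_left, polyBracket_C_right]

theorem eq_of_totalDegree_le_one {f : Poly} (hf : f.totalDegree ≤ 1) :
    f = ∑ i, coeff (Finsupp.single i 1) f • X i + C (coeff 0 f) := by
  ext d
  rw [coeff_add, coeff_sum]
  simp only [coeff_smul, coeff_X, coeff_C, smul_eq_mul]
  rcases Nat.lt_or_ge d.degree 2 with hd | hd
  · rcases Nat.lt_or_ge d.degree 1 with h0 | h0
    · have : d = 0 := by
        rw [← Finsupp.degree_eq_zero_iff]; omega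
      subst this
      simp
    · have h1 : d.degree = 1 := by omega
      obtain ⟨i, rfl⟩ := (Finsupp.sum_eq_one_iff d).1 h1
      have : (0 : Fin 3 →₀ ℕ) ≠ Finsupp.single i 1 := by
        intro h; rw [← h] at h1; simp at h1
      simp [this, Finsupp.single_left_inj, Finset.sum_ite_eq']
  · have h0 : coeff d f = 0 := by
      by_contra h
      have := le_totalDegree (mem_support_iff.2 h)
      rw [Finsupp.degree_eq_sum] at hd
      rw [Finsupp.sum_fintype _ _ (by simp)] at this
      omega
    have h1 : (0 : Fin 3 →₀ ℕ) ≠ d := by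
      rintro rfl; simp at hd
    have h2 : ∀ i : Fin 3, Finsupp.single i 1 ≠ d := by
      rintro i rfl; simp at hd
    simp [h0, h1, h2]

/-- The Poisson subalgebra `𝒫¹` of `𝒫`. -/
noncomputable def degreeLEOne (s : ℝ) : PoissonSubalgebra s where
  toSubmodule := degreeLE s 1
  bracket_mem' := by
    rintro _ _ ⟨f, hf, rfl⟩ ⟨g, hg, rfl⟩
    refine ⟨polyBracket f g, ?_, (poissonBracket_toSphere s f g).symm⟩
    have hf' := eq_of_totalDegree_le_one ((mem_restrictTotalDegree _ _ _).1 hf)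
    have hg' := eq_of_totalDegree_le_one ((mem_restrictTotalDegree _ _ _).1 hg)
    have hX : ∀ (h : Poly) (_ : h = ∑ i, coeff (Finsupp.single i 1) h • X i + C (coeff 0 h))
        (i : Fin 3), pderiv i h = C (coeff (Finsupp.single i 1) h) := by
      intro h hh i
      conv_lhs => rw [hh]
      rw [map_add, map_sum, pderiv_C, add_zero, Finset.sum_eq_single i]
      · rw [Derivation.map_smul, pderiv_X_self, smul_eq_C_mul, mul_one]
      · intro j _ hj
        rw [Derivation.map_smul, pderiv_X_of_ne hj, smul_zero]
      · simp
    have hm : ∀ i j k : Fin 3, X i * (pderiv j f * pderiv k g - pderiv k f * pderiv j g)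
        ∈ restrictTotalDegree (Fin 3) ℝ 1 := by
      intro i j k
      rw [hX f hf', hX f hf', hX g hg', hX g hg', ← C_mul, ← C_mul, ← C_sub, mul_comm,
        ← smul_eq_C_mul]
      refine Submodule.smul_mem _ _ ((mem_restrictTotalDegree _ _ _).2 ?_)
      rw [totalDegree_X]
    exact add_mem (add_mem (hm 0 1 2) (hm 1 2 0)) (hm 2 0 1)

theorem X_mem_oddPoly (i : Fin 3) : (X i : Poly) ∈ oddPoly :=
  (mem_oddPoly_iff _).2 (isWeightedHomogeneous_X ℝ _ i)

theorem degreeLEOne_le (s : ℝ) : (degreeLEOne s).toSubmodule ≤ (oddPlusConst s).toSubmodule := by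
  rintro _ ⟨f, hf, rfl⟩
  have hf' := eq_of_totalDegree_le_one ((mem_restrictTotalDegree _ _ _).1 hf)
  refine (mem_oddPlusConst_iff s _).2
    ⟨_, ?_, coeff 0 f, congrArg (toSphere s) hf'.symm⟩
  exact Submodule.sum_mem _ fun i _ => Submodule.smul_mem _ _ (X_mem_oddPoly i)

theorem spin_mem (s : ℝ) (i : Fin 3) : spin s i ∈ (oddPlusConst s).toSubmodule :=
  (mem_oddPlusConst_iff s _).2 ⟨X i, X_mem_oddPoly i, 0, by rw [C_0, add_zero]; rfl⟩

theorem spin_mul_mem (s : ℝ) (i j k : Fin 3) :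
    spin s i * spin s j * spin s k ∈ (oddPlusConst s).toSubmodule := by
  refine (mem_oddPlusConst_iff s _).2 ⟨X i * X j * X k, ?_, 0, by rw [C_0, add_zero]; rfl⟩
  rw [mem_oddPoly_iff]
  have h := fun i => isWeightedHomogeneous_X ℝ (fun _ : Fin 3 => (1 : ZMod 2)) i
  have e : (1 : ZMod 2) + 1 + 1 = 1 := by decide
  simpa [e] using ((h i).mul (h j)).mul (h k)

theorem spin_pow_three_mem (s : ℝ) (i : Fin 3) :
    spin s i ^ 3 ∈ (oddPlusConst s).toSubmodule := by
  rw [pow_three']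
  exact spin_mul_mem s i i i

/-! ### Quantizations -/

section Quantization

variable {s : ℝ} {H : Type*} [NormedAddCommGroup H] [InnerProductSpace ℂ H] [CompleteSpace H]

/-- A quantization of a Poisson subalgebra `𝒞` on the Hilbert space `H`: a real-linear map into the
self-adjoint operators that takes Poisson brackets to `-i` times commutators and, if `1 ∈ 𝒞`,
takes `1` to the identity. -/
structure IsQuantization (𝒞 : PoissonSubalgebra s) (Q : 𝒞.toSubmodule →ₗ[ℝ] (H →L[ℂ] H)) :
    Prop where
  selfAdjoint : ∀ p, IsSelfAdjoint (Q p)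
  bracket : ∀ p q : 𝒞.toSubmodule,
    Q ⟨poissonBracket s p q, 𝒞.bracket_mem' p q p.2 q.2⟩ = -Complex.I • (Q p * Q q - Q q * Q p)
  one : ∀ h : (1 : SpherePoly s) ∈ 𝒞.toSubmodule, Q ⟨1, h⟩ = 1

/-- A set of operators on `H` is irreducible if `H ≠ 0` and the only closed subspaces invariant
under all of them are `0` and `H`. -/
def IsIrreducibleSet (A : Set (H →L[ℂ] H)) : Prop :=
  Nontrivial H ∧ ∀ W : Submodule ℂ H, IsClosed (W : Set H) →
    (∀ T ∈ A, ∀ x ∈ W, T x ∈ W) → W = ⊥ ∨ W = ⊤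

/-- An admissible quantization of the pair `(𝒞, ℬ)`: a quantization of `𝒞` that is irreducible
on `ℬ ⊆ 𝒞`. -/
structure IsAdmissibleQuantization (𝒞 ℬ : PoissonSubalgebra s)
    (hle : ℬ.toSubmodule ≤ 𝒞.toSubmodule) (Q : 𝒞.toSubmodule →ₗ[ℝ] (H →L[ℂ] H)) : Prop
    extends IsQuantization 𝒞 Q where
  irreducible : IsIrreducibleSet (Set.range fun p : ℬ.toSubmodule => Q ⟨p, hle p.2⟩)

end Quantization

end SpinSphere

/-
The trilinear operator `T` with values `𝒬(S_i S_j S_k)` on the coordinate axes is symmetric, and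
commutators with the spin operators rotate its three arguments. Symmetric trilinear forms decompose
under rotations into a part of weight three and a part of weight one, so `T` vanishes as soon as
its two highest weight components do. These components commute with the raising operator `e`. In
an irreducible representation the states reached from a lowest weight vector by powers of `e` are
all states, so an operator of weight `n` commuting with `e` is a multiple of `e ^ n`. Hence two
scalars determine `T`, and comparison of highest weight components shows that `T` is a combination
of the symmetrized forms `x u * x v * x w` and `(u ⬝ᵥ v) • x w` in the spin operators `x`. The
coefficients may be taken real because all the operators involved are self-adjoint.
-/

namespace SpinSphere

attribute [local instance] LieRing.ofAssociativeRing

section Ladder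

theorem eq_of_le_of_iSupIndep_of_iSup_eq_top {α ι : Type*} [CompleteLattice α] [IsModularLattice α]
    {f g : ι → α} (hf : iSupIndep f) (hgf : g ≤ f) (hg : ⨆ i, g i = ⊤) : g = f := by
  refine le_antisymm hgf fun i ↦ ?_
  have hsplit : g i ⊔ ⨆ (j) (_ : j ≠ i), g j = ⊤ := by rw [← hg, ← iSup_split_single]
  calc f i = (g i ⊔ ⨆ (j) (_ : j ≠ i), g j) ⊓ f i := by rw [hsplit, top_inf_eq]
    _ = g i ⊔ (⨆ (j) (_ : j ≠ i), g j) ⊓ f i := sup_inf_assoc_of_le _ (hgf i)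
    _ ≤ g i ⊔ (⨆ (j) (_ : j ≠ i), f j) ⊓ f i := by gcongr with j _; exact hgf j
    _ = g i := by rw [(hf i).symm.eq_bot, sup_bot_eq]

theorem lie_pow_of_lie_eq_smul {R A : Type*} [CommRing R] [Ring A] [Algebra R A] {h x : A} {t : R}
    (hx : ⁅h, x⁆ = t • x) (n : ℕ) : ⁅h, x ^ n⁆ = (n * t) • x ^ n := by
  induction n with
  | zero => simp [Ring.lie_def]
  | succ n ih =>
    calc ⁅h, x ^ (n + 1)⁆ = ⁅h, x ^ n⁆ * x + x ^ n * ⁅h, x⁆ := by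
          simp only [Ring.lie_def, pow_succ]; noncomm_ring
      _ = ((n + 1 : ℕ) * t) • x ^ (n + 1) := by
          rw [ih, hx, smul_mul_assoc, mul_smul_comm, ← pow_succ, ← add_smul]
          push_cast; ring_nf

theorem isNilpotent_of_lie_eq_smul {𝕜 A : Type*} [RCLike 𝕜] [NormedRing A] [NormedAlgebra 𝕜 A]
    {h x : A} {t : 𝕜} (ht : t ≠ 0) (hx : ⁅h, x⁆ = t • x) : IsNilpotent x := by
  obtain ⟨n, hn⟩ := exists_nat_gt (2 * ‖h‖ / ‖t‖)
  refine ⟨n, by_contra fun hne ↦ ?_⟩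
  have hle : n * ‖t‖ * ‖x ^ n‖ ≤ 2 * ‖h‖ * ‖x ^ n‖ :=
    calc n * ‖t‖ * ‖x ^ n‖ = ‖⁅h, x ^ n⁆‖ := by
          rw [lie_pow_of_lie_eq_smul hx, norm_smul, norm_mul, RCLike.norm_natCast]
      _ ≤ ‖h * x ^ n‖ + ‖x ^ n * h‖ := norm_sub_le _ _
      _ ≤ ‖h‖ * ‖x ^ n‖ + ‖x ^ n‖ * ‖h‖ := add_le_add (norm_mul_le _ _) (norm_mul_le _ _)
      _ = 2 * ‖h‖ * ‖x ^ n‖ := by ring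
  rw [div_lt_iff₀ (norm_pos_iff.2 ht)] at hn
  exact hn.not_ge (le_of_mul_le_mul_right hle (norm_pos_iff.2 hne))

theorem exists_ne_zero_apply_eq_zero_of_isNilpotent {R M : Type*} [Ring R]
    [AddCommGroup M] [Module R M] [Nontrivial M] {f : Module.End R M} (hf : IsNilpotent f) :
    ∃ v ≠ 0, f v = 0 := by
  by_contra! hne
  obtain ⟨n, hn⟩ := hf
  have hinj : Function.Injective (f ^ n) := by
    rw [Module.End.coe_pow]
    exact ((injective_iff_map_eq_zero f).2 fun v hv ↦ by_contra fun h0 ↦ hne v h0 hv).iterate n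
  obtain ⟨v, hv⟩ := exists_ne (0 : M)
  exact hv (hinj (by simp [hn]))

/-- Elements satisfying the commutation relations of the spin component along an axis and of the
associated raising and lowering operators: `IsSl2Triple (2 • h) e f` without the requirement
`h ≠ 0`, which fails in the trivial representation. -/
structure IsAngularMomentumTriple {L : Type*} [LieRing L] (h e f : L) : Prop where
  lie_h_e : ⁅h, e⁆ = e
  lie_h_f : ⁅h, f⁆ = -f
  lie_e_f : ⁅e, f⁆ = 2 • h

namespace IsAngularMomentumTriple

theorem map {A B : Type*} [Ring A] [Ring B] {h e f : A} (t : IsAngularMomentumTriple h e f)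
    (φ : A →+* B) : IsAngularMomentumTriple (φ h) (φ e) (φ f) where
  lie_h_e := by simpa [Ring.lie_def] using congrArg φ t.lie_h_e
  lie_h_f := by simpa [Ring.lie_def] using congrArg φ t.lie_h_f
  lie_e_f := by simpa only [Ring.lie_def, map_sub, map_mul, map_nsmul] using congrArg φ t.lie_e_f

theorem lie_f_pow_succ {A : Type*} [Ring A] {h e f : A} (t : IsAngularMomentumTriple h e f)
    (n : ℕ) : ⁅f, e ^ (n + 1)⁆ = -((n + 1) • (2 • (e ^ n * h) + n • e ^ n)) := by
  have hfe : ⁅f, e⁆ = -(2 • h) := by rw [← lie_skew, t.lie_e_f]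
  have hhe : h * e = e * h + e := by rw [← sub_eq_iff_eq_add', ← Ring.lie_def, t.lie_h_e]
  induction n with
  | zero => simp [hfe]
  | succ n ih =>
    calc ⁅f, e ^ (n + 1 + 1)⁆ = ⁅f, e ^ (n + 1)⁆ * e + e ^ (n + 1) * ⁅f, e⁆ := by
          simp only [Ring.lie_def, pow_succ]; noncomm_ring
      _ = -((n + 1) • (2 • (e ^ n * (h * e)) + n • e ^ (n + 1))) - 2 • (e ^ (n + 1) * h) := by
          rw [ih, hfe]
          simp only [neg_mul, add_mul, smul_mul_assoc, mul_smul_comm, mul_neg, mul_assoc, pow_succ,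
            sub_eq_add_neg]
      _ = -((n + 1 + 1) • (2 • (e ^ (n + 1) * h) + (n + 1) • e ^ (n + 1))) := by
          rw [hhe, mul_add, ← mul_assoc, ← pow_succ]; module

section Representation

variable {K V : Type*} [Field K] [AddCommGroup V] [Module K V] {h e f : Module.End K V}

theorem f_pow_succ_apply (t : IsAngularMomentumTriple h e f) {u : V} (hu : f u = 0) (n : ℕ) :
    f ((e ^ (n + 1)) u) = -((n + 1 : K) • (e ^ n) (((2 : K) • h + (n : K) • 1) u)) := by
  have := LinearMap.congr_fun (t.lie_f_pow_succ n) u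
  simp only [Ring.lie_def, LinearMap.sub_apply, Module.End.mul_apply, hu, map_zero,
    sub_zero] at this
  rw [this]
  simp [← Nat.cast_smul_eq_nsmul K]

theorem h_pow_apply (t : IsAngularMomentumTriple h e f) {u : V} {μ : K} (hu : h u = μ • u) (n : ℕ) :
    h ((e ^ n) u) = (μ + n) • (e ^ n) u := by
  have hlie : ⁅h, e ^ n⁆ = (n : K) • e ^ n := by
    simpa using lie_pow_of_lie_eq_smul (t := (1 : K)) (by rw [t.lie_h_e, one_smul]) n
  have := LinearMap.congr_fun hlie u
  rw [Ring.lie_def, LinearMap.sub_apply, sub_eq_iff_eq_add, Module.End.mul_apply,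
    Module.End.mul_apply, hu, map_smul, LinearMap.smul_apply] at this
  rw [this, add_comm, add_smul]

theorem exists_lowest_weight_vector [CharZero K] [Nontrivial V] (t : IsAngularMomentumTriple h e f)
    (he : IsNilpotent e) (hf : IsNilpotent f) :
    ∃ u ≠ 0, f u = 0 ∧ ∃ μ : K, h u = μ • u := by
  classical
  obtain ⟨n, hn⟩ := he
  obtain ⟨v, hv, hfv⟩ := exists_ne_zero_apply_eq_zero_of_isNilpotent hf
  -- A vector killed by `f` is a weight vector as soon as the power of `e` killing it is minimal.
  have hex : ∃ n, ∃ w ≠ 0, f w = 0 ∧ (e ^ n) w = 0 := ⟨n, v, hv, hfv, by rw [hn]; rfl⟩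
  obtain ⟨w, hw, hfw, hew⟩ := Nat.find_spec hex
  obtain ⟨k, hk⟩ : ∃ k, Nat.find hex = k + 1 :=
    Nat.exists_eq_succ_of_ne_zero fun h0 ↦ hw (by simpa [h0] using hew)
  refine ⟨w, hw, hfw, -(k / 2 : K), ?_⟩
  set w' := ((2 : K) • h + (k : K) • 1) w with hw'
  have hfh : f (h w) = 0 := by
    have := LinearMap.congr_fun t.lie_h_f w
    simpa [Ring.lie_def, hfw] using this
  have hfw' : f w' = 0 := by simp [hw', hfh, hfw]
  have hew' : (e ^ k) w' = 0 := by
    have := t.f_pow_succ_apply hfw k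
    rw [← hk, hew, map_zero, zero_eq_neg, smul_eq_zero] at this
    exact this.resolve_left k.cast_add_one_ne_zero
  have hzero : w' = 0 := by_contra fun hne ↦
    Nat.find_min hex (by omega : k < _) ⟨w', hne, hfw', hew'⟩
  rw [hw', LinearMap.add_apply, LinearMap.smul_apply, LinearMap.smul_apply, Module.End.one_apply,
    add_eq_zero_iff_eq_neg, ← neg_smul] at hzero
  rw [← inv_smul_smul₀ (two_ne_zero' K) (h w), hzero, smul_smul, div_eq_inv_mul, mul_neg]

end Representation

end IsAngularMomentumTriple

/-- The span of `u, e u, e² u, …`: the states reached from `u` by the raising operator `e`. -/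
def ladderSpan {K V : Type*} [Field K] [AddCommGroup V] [Module K V] (e : Module.End K V) (u : V) :
    Submodule K V :=
  Submodule.span K (Set.range fun n : ℕ ↦ (e ^ n) u)

section LadderSpan

variable {K V : Type*} [Field K] [AddCommGroup V] [Module K V] {h e f : Module.End K V} {u : V}

theorem pow_apply_mem_ladderSpan (e : Module.End K V) (u : V) (n : ℕ) :
    (e ^ n) u ∈ ladderSpan e u :=
  Submodule.subset_span ⟨n, rfl⟩

theorem apply_mem_ladderSpan {g : Module.End K V} (hg : ∀ n : ℕ, g ((e ^ n) u) ∈ ladderSpan e u)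
    {v : V} (hv : v ∈ ladderSpan e u) : g v ∈ ladderSpan e u :=
  (Submodule.span_le (p := (ladderSpan e u).comap g)).2 (Set.range_subset_iff.2 hg) hv

theorem finiteDimensional_ladderSpan (he : IsNilpotent e) (u : V) :
    FiniteDimensional K (ladderSpan e u) := by
  obtain ⟨N, hN⟩ := he
  refine FiniteDimensional.span_of_finite K (((Set.finite_Iio N).image fun n ↦ (e ^ n) u).insert 0
    |>.subset (Set.range_subset_iff.2 fun n ↦ ?_))
  rcases lt_or_ge n N with hlt | hle
  · exact Or.inr ⟨n, hlt, rfl⟩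
  · exact Or.inl (by rw [pow_eq_zero_of_le hle hN, LinearMap.zero_apply])

namespace IsAngularMomentumTriple

theorem apply_mem_ladderSpan (t : IsAngularMomentumTriple h e f) {μ : K} (hf : f u = 0)
    (hh : h u = μ • u) {g : Module.End K V} (hg : g ∈ ({h, e, f} : Set (Module.End K V)))
    {v : V} (hv : v ∈ ladderSpan e u) : g v ∈ ladderSpan e u := by
  refine SpinSphere.apply_mem_ladderSpan (fun n ↦ ?_) hv
  rcases hg with rfl | rfl | rfl
  · rw [t.h_pow_apply hh]
    exact Submodule.smul_mem _ _ (pow_apply_mem_ladderSpan e u n)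
  · rw [← Module.End.mul_apply, ← pow_succ']
    exact pow_apply_mem_ladderSpan g u (n + 1)
  · cases n with
    | zero => simp [hf]
    | succ n =>
      rw [t.f_pow_succ_apply hf, LinearMap.add_apply, LinearMap.smul_apply, LinearMap.smul_apply,
        Module.End.one_apply, hh, smul_smul, ← add_smul, map_smul]
      exact neg_mem (Submodule.smul_mem _ _ (Submodule.smul_mem _ _
        (pow_apply_mem_ladderSpan e u n)))

theorem eigenspace_eq_span [CharZero K] (t : IsAngularMomentumTriple h e f) {μ : K}
    (hh : h u = μ • u) (htop : ladderSpan e u = ⊤) (n : ℕ) :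
    h.eigenspace (μ + n) = Submodule.span K {(e ^ n) u} := by
  have hindep : iSupIndep fun n : ℕ ↦ h.eigenspace (μ + n) :=
    h.eigenspaces_iSupIndep.comp ((add_right_injective μ).comp Nat.cast_injective)
  refine (congrFun (eq_of_le_of_iSupIndep_of_iSup_eq_top (g := fun n ↦ Submodule.span K {(e ^ n) u})
    hindep (fun m ↦ ?_) ?_) n).symm
  · rw [Submodule.span_singleton_le_iff_mem, Module.End.mem_eigenspace_iff]
    exact t.h_pow_apply hh m
  · rw [← Submodule.span_range_eq_iSup]
    exact htop

theorem exists_eq_smul_pow_of_ladderSpan_eq_top [CharZero K] (t : IsAngularMomentumTriple h e f)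
    {μ : K} (hh : h u = μ • u) (htop : ladderSpan e u = ⊤) {n : ℕ} {y : Module.End K V}
    (hhy : ⁅h, y⁆ = n • y) (hey : Commute e y) : ∃ a : K, y = a • e ^ n := by
  have hyu : y u ∈ h.eigenspace (μ + n) := by
    have := LinearMap.congr_fun hhy u
    rw [Ring.lie_def, LinearMap.sub_apply, sub_eq_iff_eq_add', Module.End.mul_apply,
      Module.End.mul_apply, hh, map_smul, LinearMap.smul_apply, ← Nat.cast_smul_eq_nsmul K] at this
    rw [Module.End.mem_eigenspace_iff, this, add_smul]
  rw [t.eigenspace_eq_span hh htop] at hyu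
  obtain ⟨a, ha⟩ := Submodule.mem_span_singleton.1 hyu
  refine ⟨a, LinearMap.ext_on_range htop fun k ↦ ?_⟩
  rw [← Module.End.mul_apply, ← (hey.pow_left k).eq, Module.End.mul_apply, ← ha, map_smul,
    LinearMap.smul_apply, ← Module.End.mul_apply, ← Module.End.mul_apply, ← pow_add, ← pow_add,
    add_comm]

end IsAngularMomentumTriple

end LadderSpan

end Ladder

section Irreducible

variable {H : Type*} [NormedAddCommGroup H] [InnerProductSpace ℂ H]

theorem IsIrreducibleSet.of_subset_adjoin {A B : Set (H →L[ℂ] H)} (hA : IsIrreducibleSet A)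
    (hAB : A ⊆ Algebra.adjoin ℂ B) : IsIrreducibleSet B := by
  refine ⟨hA.1, fun W hW hBW ↦ hA.2 W hW fun T hT ↦ ?_⟩
  replace hT := hAB hT
  induction hT using Algebra.adjoin_induction with
  | mem T hT => exact hBW T hT
  | algebraMap c => exact fun x hx ↦ W.smul_mem c hx
  | add _ _ _ _ h₁ h₂ => exact fun x hx ↦ W.add_mem (h₁ x hx) (h₂ x hx)
  | mul _ T₂ _ _ h₁ h₂ => exact fun x hx ↦ h₁ _ (h₂ x hx)

theorem IsAngularMomentumTriple.exists_eq_smul_pow {h e f : H →L[ℂ] H}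
    (t : IsAngularMomentumTriple h e f) (hirr : IsIrreducibleSet {h, e, f}) {n : ℕ}
    {y : H →L[ℂ] H} (hhy : ⁅h, y⁆ = n • y) (hey : Commute e y) : ∃ a : ℂ, y = a • e ^ n := by
  have := hirr.1
  have he : IsNilpotent e :=
    isNilpotent_of_lie_eq_smul (one_ne_zero' ℂ) (by rw [t.lie_h_e, one_smul])
  have hf : IsNilpotent f :=
    isNilpotent_of_lie_eq_smul (neg_ne_zero.2 (one_ne_zero' ℂ)) (by rw [t.lie_h_f, neg_one_smul])
  let φ : (H →L[ℂ] H) →+* Module.End ℂ H := ContinuousLinearMap.toLinearMapRingHom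
  obtain ⟨u, hu, hfu, μ, hhu⟩ := (t.map φ).exists_lowest_weight_vector (he.map φ) (hf.map φ)
  have hfin := finiteDimensional_ladderSpan (he.map φ) u
  have htop : ladderSpan (φ e) u = ⊤ := by
    refine (hirr.2 _ (ladderSpan (φ e) u).closed_of_finiteDimensional
      fun T hT v hv ↦ ?_).resolve_left fun hbot ↦ hu ?_
    · refine (t.map φ).apply_mem_ladderSpan hfu hhu (g := φ T) ?_ hv
      rcases hT with rfl | rfl | rfl <;> simp
    · simpa [hbot] using pow_apply_mem_ladderSpan (φ e) u 0
  obtain ⟨a, ha⟩ := (t.map φ).exists_eq_smul_pow_of_ladderSpan_eq_top hhu htop (y := φ y)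
    (by simpa [Ring.lie_def] using congrArg φ hhy) (hey.map φ)
  refine ⟨a, ContinuousLinearMap.coe_injective ?_⟩
  simpa [φ] using ha

end Irreducible

section TensorOperators

open Complex Matrix

local notation "ℂ³" => Fin 3 → ℂ

/-- The spin-one representation: the direction `u` acts on vectors by `v ↦ i u × v`. -/
noncomputable def spinOne : ℂ³ →ₗ[ℂ] Module.End ℂ ℂ³ :=
  I • crossProduct

theorem spinOne_apply (u v : ℂ³) : spinOne u v = I • (u ⨯₃ v) := rfl

theorem spinOne_spinOne_self (u v : ℂ³) :
    spinOne u (spinOne u v) = (u ⬝ᵥ u) • v - (u ⬝ᵥ v) • u := by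
  rw [spinOne_apply, spinOne_apply, map_smul, smul_smul, I_mul_I, neg_one_smul]
  ext i
  fin_cases i <;>
    simp only [cross_apply, vec3_dotProduct, Pi.neg_apply, Pi.sub_apply, Pi.smul_apply, smul_eq_mul,
      Fin.mk_one, Fin.zero_eta, Fin.reduceFinMk, cons_val] <;>
    ring

theorem spinOne_dotProduct_add (u v w : ℂ³) : spinOne u v ⬝ᵥ w + v ⬝ᵥ spinOne u w = 0 := by
  simp only [spinOne_apply, cross_apply, vec3_dotProduct, Pi.smul_apply, smul_eq_mul, cons_val]
  ring

/-- The Levi-Civita symbol `ε_{ijk}`, the structure constants of the spin components. -/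
def leviCivita (i j k : Fin 3) : ℤ := (Pi.single i 1 ⨯₃ Pi.single j 1) k

theorem spinOne_single (i j : Fin 3) :
    spinOne (Pi.single i 1) (Pi.single j 1) = I • ∑ k, leviCivita i j k • Pi.single k 1 := by
  rw [spinOne_apply]
  congr 1
  ext k
  fin_cases i <;> fin_cases j <;> fin_cases k <;>
    simp [leviCivita, Fin.sum_univ_three, cross_apply]

theorem single_induction {p : ℂ³ → Prop} (add : ∀ u v, p u → p v → p (u + v))
    (smul : ∀ (c : ℂ) u, p u → p (c • u)) (single : ∀ i, p (Pi.single i 1)) (u : ℂ³) : p u := by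
  have hu := (Pi.basisFun ℂ (Fin 3)).mem_span u
  induction hu using Submodule.span_induction with
  | mem u hu => obtain ⟨i, rfl⟩ := hu; simpa only [Pi.basisFun_apply] using single i
  | zero => simpa using smul 0 _ (single 0)
  | add u v _ _ hu hv => exact add u v hu hv
  | smul c u _ hu => exact smul c u hu

theorem cross_single : (Pi.single 0 1 ⨯₃ Pi.single 1 1 : ℂ³) = Pi.single 2 1 ∧
    (Pi.single 1 1 ⨯₃ Pi.single 2 1 : ℂ³) = Pi.single 0 1 ∧
    (Pi.single 2 1 ⨯₃ Pi.single 0 1 : ℂ³) = Pi.single 1 1 := by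
  refine ⟨?_, ?_, ?_⟩ <;> ext k <;> fin_cases k <;> simp [cross_apply]

/-- The quantization axis, the third coordinate axis. -/
def axisDir : ℂ³ := ![0, 0, 1]

/-- The isotropic direction along which a vector of spin operators has the raising operator
`S₁ + i S₂` as component. -/
noncomputable def raisingDir : ℂ³ := ![1, I, 0]

/-- The isotropic direction along which a vector of spin operators has the lowering operator
`S₁ - i S₂` as component. -/
noncomputable def loweringDir : ℂ³ := ![1, -I, 0]

theorem spinOne_self (u : ℂ³) : spinOne u u = 0 := by
  rw [spinOne_apply, cross_self, smul_zero]

theorem spinOne_axisDir_raisingDir : spinOne axisDir raisingDir = raisingDir := by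
  ext i; fin_cases i <;> simp [spinOne_apply, cross_apply, axisDir, raisingDir]

theorem spinOne_axisDir_loweringDir : spinOne axisDir loweringDir = -loweringDir := by
  ext i; fin_cases i <;> simp [spinOne_apply, cross_apply, axisDir, loweringDir]

theorem spinOne_raisingDir_axisDir : spinOne raisingDir axisDir = -raisingDir := by
  ext i; fin_cases i <;> simp [spinOne_apply, cross_apply, axisDir, raisingDir]

theorem spinOne_raisingDir_loweringDir :
    spinOne raisingDir loweringDir = (2 : ℂ) • axisDir := by
  ext i; fin_cases i <;>
    simp [spinOne_apply, cross_apply, axisDir, raisingDir, loweringDir, mul_sub, one_add_one_eq_two]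

theorem spinOne_loweringDir_axisDir : spinOne loweringDir axisDir = loweringDir := by
  ext i; fin_cases i <;> simp [spinOne_apply, cross_apply, axisDir, loweringDir]

theorem spinOne_loweringDir_raisingDir :
    spinOne loweringDir raisingDir = (-2 : ℂ) • axisDir := by
  rw [neg_smul, ← spinOne_raisingDir_loweringDir, spinOne_apply, spinOne_apply, ← smul_neg,
    cross_anticomm]

theorem eq_smul_raisingDir_add_smul_axisDir_add_smul_loweringDir (u : ℂ³) :
    u = ((u 0 - I * u 1) / 2) • raisingDir + u 2 • axisDir
      + ((u 0 + I * u 1) / 2) • loweringDir := by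
  have h₀ : u 0 = (u 0 - I * u 1) / 2 + (u 0 + I * u 1) / 2 := by ring
  have h₁ : u 1 = (u 0 - I * u 1) / 2 * I - (u 0 + I * u 1) / 2 * I := by
    linear_combination u 1 * I_sq
  ext i
  fin_cases i
  · simpa [axisDir, raisingDir, loweringDir] using h₀
  · simpa [axisDir, raisingDir, loweringDir, sub_eq_add_neg] using h₁
  · simp [axisDir, raisingDir, loweringDir]

theorem eq_zero_of_raisingDir_axisDir_loweringDir {M : Type*} [AddCommGroup M] [Module ℂ M]
    {g : ℂ³ →ₗ[ℂ] M} (hr : g raisingDir = 0) (ha : g axisDir = 0) (hl : g loweringDir = 0) :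
    g = 0 := by
  refine LinearMap.ext fun u ↦ ?_
  rw [eq_smul_raisingDir_add_smul_axisDir_add_smul_loweringDir u]
  simp only [map_add, map_smul, hr, ha, hl, smul_zero, add_zero, LinearMap.zero_apply]

local notation "e₊" => raisingDir
local notation "e₀" => axisDir
local notation "e₋" => loweringDir

section TrilinearForms

variable {M : Type*} [AddCommGroup M] [Module ℂ M] {x : ℂ³ →ₗ[ℂ] M}
  {T : ℂ³ →ₗ[ℂ] ℂ³ →ₗ[ℂ] ℂ³ →ₗ[ℂ] M}

/-- The trilinear forms invariant under permutations of their arguments, expressed through the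
transpositions of adjacent arguments. -/
def symmetricForms (M : Type*) [AddCommGroup M] [Module ℂ M] :
    Submodule ℂ (ℂ³ →ₗ[ℂ] ℂ³ →ₗ[ℂ] ℂ³ →ₗ[ℂ] M) where
  carrier := {T | ∀ u v w, T u v w = T v u w ∧ T u v w = T u w v}
  zero_mem' := by simp
  add_mem' hS hT u v w :=
    ⟨congrArg₂ (· + ·) (hS u v w).1 (hT u v w).1, congrArg₂ (· + ·) (hS u v w).2 (hT u v w).2⟩
  smul_mem' c T hT u v w :=
    ⟨congrArg (c • ·) (hT u v w).1, congrArg (c • ·) (hT u v w).2⟩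

theorem mem_symmetricForms_of_single
    (h : ∀ i j k : Fin 3, T (Pi.single i 1) (Pi.single j 1) (Pi.single k 1) =
      T (Pi.single j 1) (Pi.single i 1) (Pi.single k 1) ∧
      T (Pi.single i 1) (Pi.single j 1) (Pi.single k 1) =
      T (Pi.single i 1) (Pi.single k 1) (Pi.single j 1)) :
    T ∈ symmetricForms M := by
  intro u v w
  induction u using single_induction with
  | add u u' hu hu' =>
    constructor <;> simp only [map_add, LinearMap.add_apply, hu.1, hu'.1, ← hu.2, ← hu'.2]
  | smul c u hu => constructor <;> simp only [map_smul, LinearMap.smul_apply, hu.1, ← hu.2]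
  | single i =>
    induction v using single_induction with
    | add v v' hv hv' =>
      constructor <;> simp only [map_add, LinearMap.add_apply, hv.1, hv'.1, ← hv.2, ← hv'.2]
    | smul c v hv => constructor <;> simp only [map_smul, LinearMap.smul_apply, hv.1, ← hv.2]
    | single j =>
      induction w using single_induction with
      | add w w' hw hw' =>
        constructor <;> simp only [map_add, LinearMap.add_apply, hw.1, hw'.1, ← hw.2, ← hw'.2]
      | smul c w hw => constructor <;> simp only [map_smul, LinearMap.smul_apply, hw.1, ← hw.2]
      | single k => exact h i j k

/-- The average of a trilinear form over the permutations of its arguments. -/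
noncomputable def symmetrize (T : ℂ³ →ₗ[ℂ] ℂ³ →ₗ[ℂ] ℂ³ →ₗ[ℂ] M) :
    ℂ³ →ₗ[ℂ] ℂ³ →ₗ[ℂ] ℂ³ →ₗ[ℂ] M :=
  let T' := LinearMap.lflip.toLinearMap ∘ₗ T
  let T'' := LinearMap.lflip.toLinearMap ∘ₗ T.flip
  (1 / 6 : ℂ) • (T + T.flip + T' + T'.flip + T'' + T''.flip)

theorem symmetrize_apply (T : ℂ³ →ₗ[ℂ] ℂ³ →ₗ[ℂ] ℂ³ →ₗ[ℂ] M) (u v w : ℂ³) :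
    symmetrize T u v w =
      (1 / 6 : ℂ) • (T u v w + T v u w + T u w v + T v w u + T w u v + T w v u) := rfl

theorem symmetrize_mem_symmetricForms (T : ℂ³ →ₗ[ℂ] ℂ³ →ₗ[ℂ] ℂ³ →ₗ[ℂ] M) :
    symmetrize T ∈ symmetricForms M := fun u v w ↦ by
  constructor <;> simp only [symmetrize_apply] <;> module

/-- The form `u v w ↦ (u ⬝ᵥ v) • x w`; its symmetrization is the weight one part of a symmetric
tensor operator. -/
noncomputable def traceForm (x : ℂ³ →ₗ[ℂ] M) : ℂ³ →ₗ[ℂ] ℂ³ →ₗ[ℂ] ℂ³ →ₗ[ℂ] M :=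
  (dotProductBilin ℂ ℂ).compr₂ (LinearMap.toSpanSingleton ℂ _ x)

theorem traceForm_apply (x : ℂ³ →ₗ[ℂ] M) (u v w : ℂ³) :
    traceForm x u v w = (u ⬝ᵥ v) • x w := rfl

theorem symmetrize_traceForm_self (x : ℂ³ →ₗ[ℂ] M) (u : ℂ³) :
    symmetrize (traceForm x) u u u = (u ⬝ᵥ u) • x u := by
  simp only [symmetrize_apply, traceForm_apply]
  module

theorem symmetrize_traceForm_apply_apply_self (x : ℂ³ →ₗ[ℂ] M) (u v : ℂ³) :
    symmetrize (traceForm x) u v u = (1 / 3 : ℂ) • ((u ⬝ᵥ u) • x v + (2 * u ⬝ᵥ v) • x u) := by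
  simp only [symmetrize_apply, traceForm_apply, dotProduct_comm v u]
  module

theorem symmetrize_traceForm_of_cross_eq (x : ℂ³ →ₗ[ℂ] M) {u v w : ℂ³}
    (huv : u ⨯₃ v = w) (hvw : v ⨯₃ w = u) (hwu : w ⨯₃ u = v) :
    symmetrize (traceForm x) u v w = 0 := by
  have huv₀ : u ⬝ᵥ v = 0 := by rw [← hwu, dot_cross_self]
  have hvw₀ : v ⬝ᵥ w = 0 := by rw [← huv, dot_cross_self]
  have hwu₀ : w ⬝ᵥ u = 0 := by rw [← hvw, dot_cross_self]
  simp only [symmetrize_apply, traceForm_apply, dotProduct_comm v u, dotProduct_comm w v,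
    dotProduct_comm u w, huv₀, hvw₀, hwu₀, zero_smul, add_zero, smul_zero]

theorem symmetrize_traceForm_raisingDir_add (x : ℂ³ →ₗ[ℂ] M) :
    symmetrize (traceForm x) e₊ e₊ e₋ + symmetrize (traceForm x) e₊ e₀ e₀ = (5 / 3 : ℂ) • x e₊ := by
  have hrr : e₊ ⬝ᵥ e₊ = 0 := by simp [raisingDir]
  have hrl : e₊ ⬝ᵥ e₋ = 2 := by simp [raisingDir, loweringDir, one_add_one_eq_two]
  have hra : e₊ ⬝ᵥ e₀ = 0 := by simp [raisingDir, axisDir]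
  have haa : e₀ ⬝ᵥ e₀ = 1 := by simp [axisDir]
  simp only [symmetrize_apply, traceForm_apply, dotProduct_comm e₋ e₊, dotProduct_comm e₀ e₊, hrr,
    hrl, hra, haa]
  module

theorem isSelfAdjoint_symmetrize_traceForm [StarAddMonoid M] [StarModule ℂ M] {u v w : ℂ³}
    (hu : IsSelfAdjoint u) (hv : IsSelfAdjoint v) (hw : IsSelfAdjoint w)
    (hxu : IsSelfAdjoint (x u)) (hxv : IsSelfAdjoint (x v)) (hxw : IsSelfAdjoint (x w)) :
    IsSelfAdjoint (symmetrize (traceForm x) u v w) := by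
  have hstar : star (1 / 6 : ℂ) = 1 / 6 := by simp
  have hdot {p q : ℂ³} (hp : IsSelfAdjoint p) (hq : IsSelfAdjoint q) :
      star (p ⬝ᵥ q) = p ⬝ᵥ q := by
    rw [← star_dotProduct_star, hp.star_eq, hq.star_eq, dotProduct_comm]
  simp only [IsSelfAdjoint, symmetrize_apply, traceForm_apply, star_smul, star_add, hdot hu hv,
    hdot hv hu, hdot hv hw, hdot hw hv, hdot hu hw, hdot hw hu, hxu.star_eq, hxv.star_eq,
    hxw.star_eq, hstar]

theorem eq_zero_of_components_eq_zero (hsymm : T ∈ symmetricForms M) (hrrr : T e₊ e₊ e₊ = 0)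
    (hrra : T e₊ e₊ e₀ = 0) (hrrl : T e₊ e₊ e₋ = 0) (hraa : T e₊ e₀ e₀ = 0) (hral : T e₊ e₀ e₋ = 0)
    (hrll : T e₊ e₋ e₋ = 0) (haaa : T e₀ e₀ e₀ = 0) (haal : T e₀ e₀ e₋ = 0) (hall : T e₀ e₋ e₋ = 0)
    (hlll : T e₋ e₋ e₋ = 0) : T = 0 := by
  have swap₁₂ (u v) : T u v = T v u := LinearMap.ext fun w ↦ (hsymm u v w).1
  have swap₂₃ (u v w) : T u v w = T u w v := (hsymm u v w).2
  have ext_zero {N : Type _} [AddCommGroup N] [Module ℂ N] {g : ℂ³ →ₗ[ℂ] N} :=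
    eq_zero_of_raisingDir_axisDir_loweringDir (g := g)
  have hrr : T e₊ e₊ = 0 := ext_zero hrrr hrra hrrl
  have hra : T e₊ e₀ = 0 := ext_zero (by rw [swap₂₃, hrra]) hraa hral
  have hrl : T e₊ e₋ = 0 := ext_zero (by rw [swap₂₃, hrrl]) (by rw [swap₂₃, hral]) hrll
  have haa : T e₀ e₀ = 0 := ext_zero (by rw [swap₂₃, swap₁₂, hraa]) haaa haal
  have hal : T e₀ e₋ = 0 :=
    ext_zero (by rw [swap₂₃, swap₁₂, hral]) (by rw [swap₂₃, haal]) hall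
  have hll : T e₋ e₋ = 0 :=
    ext_zero (by rw [swap₂₃, swap₁₂, hrll]) (by rw [swap₂₃, swap₁₂, hall]) hlll
  exact ext_zero (ext_zero hrr hra hrl) (ext_zero (by rw [swap₁₂, hra]) haa hal)
    (ext_zero (by rw [swap₁₂, hrl]) (by rw [swap₁₂, hal]) hll)

end TrilinearForms

section Ring

variable {A : Type*} [Ring A] [Algebra ℂ A] {x : ℂ³ →ₗ[ℂ] A} {T : ℂ³ →ₗ[ℂ] ℂ³ →ₗ[ℂ] ℂ³ →ₗ[ℂ] A}

/-- A vector of spin operators, given by its component `x u` in every complex direction `u`. -/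
def IsSpinVector (x : ℂ³ →ₗ[ℂ] A) : Prop :=
  ∀ u v, ⁅x u, x v⁆ = x (spinOne u v)

theorem IsSpinVector.of_single (h : ∀ i j : Fin 3, ⁅x (Pi.single i 1), x (Pi.single j 1)⁆ =
    x (spinOne (Pi.single i 1) (Pi.single j 1))) : IsSpinVector x := by
  intro u v
  induction u using single_induction with
  | add u u' hu hu' => simp only [map_add, add_lie, LinearMap.add_apply, hu, hu']
  | smul c u hu => simp only [map_smul, smul_lie, LinearMap.smul_apply, hu]
  | single i =>
    induction v using single_induction with
    | add v v' hv hv' => simp only [map_add, lie_add, hv, hv']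
    | smul c v hv => simp only [map_smul, lie_smul, hv]
    | single j => exact h i j

theorem IsSpinVector.isAngularMomentumTriple (hx : IsSpinVector x) :
    IsAngularMomentumTriple (x axisDir) (x raisingDir) (x loweringDir) where
  lie_h_e := by rw [hx, spinOne_axisDir_raisingDir]
  lie_h_f := by rw [hx, spinOne_axisDir_loweringDir, map_neg]
  lie_e_f := by rw [hx, spinOne_raisingDir_loweringDir, map_smul, ofNat_smul_eq_nsmul]

/-- The operator-valued trilinear forms on which the commutator with `x` acts through the spin-one
representation in each argument: the Cartesian tensor operators of rank three. -/
def tensorOperators (x : ℂ³ →ₗ[ℂ] A) : Submodule ℂ (ℂ³ →ₗ[ℂ] ℂ³ →ₗ[ℂ] ℂ³ →ₗ[ℂ] A) where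
  carrier := {T | ∀ u v w z, ⁅x u, T v w z⁆ =
    T (spinOne u v) w z + T v (spinOne u w) z + T v w (spinOne u z)}
  zero_mem' := by simp
  add_mem' hS hT u v w z := by
    simp only [LinearMap.add_apply, lie_add, hS u v w z, hT u v w z]; abel
  smul_mem' c T hT u v w z := by
    simp only [LinearMap.smul_apply, lie_smul, hT u v w z, smul_add]

theorem mem_tensorOperators_of_single
    (h : ∀ n i j k : Fin 3, ⁅x (Pi.single n 1), T (Pi.single i 1) (Pi.single j 1) (Pi.single k 1)⁆ =
      T (spinOne (Pi.single n 1) (Pi.single i 1)) (Pi.single j 1) (Pi.single k 1)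
        + T (Pi.single i 1) (spinOne (Pi.single n 1) (Pi.single j 1)) (Pi.single k 1)
        + T (Pi.single i 1) (Pi.single j 1) (spinOne (Pi.single n 1) (Pi.single k 1))) :
    T ∈ tensorOperators x := by
  intro u v w z
  induction u using single_induction with
  | add u u' hu hu' => simp only [map_add, add_lie, LinearMap.add_apply, hu, hu']; abel
  | smul c u hu => simp only [map_smul, smul_lie, LinearMap.smul_apply, hu, smul_add]
  | single n =>
    induction v using single_induction with
    | add v v' hv hv' => simp only [map_add, lie_add, LinearMap.add_apply, hv, hv']; abel
    | smul c v hv => simp only [map_smul, lie_smul, LinearMap.smul_apply, hv, smul_add]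
    | single i =>
      induction w using single_induction with
      | add w w' hw hw' => simp only [map_add, lie_add, LinearMap.add_apply, hw, hw']; abel
      | smul c w hw => simp only [map_smul, lie_smul, LinearMap.smul_apply, hw, smul_add]
      | single j =>
        induction z using single_induction with
        | add z z' hz hz' => simp only [map_add, lie_add, hz, hz']; abel
        | smul c z hz => simp only [map_smul, lie_smul, hz, smul_add]
        | single k => exact h n i j k

theorem symmetrize_mem_tensorOperators (hT : T ∈ tensorOperators x) :
    symmetrize T ∈ tensorOperators x := fun u v w z ↦ by
  simp only [symmetrize_apply, lie_smul, lie_add, hT u _ _ _]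
  module

/-- The form `u v w ↦ x u * x v * x w`; its symmetrization quantizes the cubic monomials up to lower
order terms. -/
noncomputable def cubeForm (x : ℂ³ →ₗ[ℂ] A) : ℂ³ →ₗ[ℂ] ℂ³ →ₗ[ℂ] ℂ³ →ₗ[ℂ] A :=
  ((LinearMap.mul ℂ A).compl₁₂ x x).compr₂ (LinearMap.lcomp ℂ A x ∘ₗ LinearMap.mul ℂ A)

theorem cubeForm_apply (x : ℂ³ →ₗ[ℂ] A) (u v w : ℂ³) : cubeForm x u v w = x u * x v * x w := rfl

theorem IsSpinVector.cubeForm_mem_tensorOperators (hx : IsSpinVector x) :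
    cubeForm x ∈ tensorOperators x := fun u v w z ↦ by
  simp only [cubeForm_apply, ← hx _ _, Ring.lie_def]
  noncomm_ring

theorem IsSpinVector.traceForm_mem_tensorOperators (hx : IsSpinVector x) :
    traceForm x ∈ tensorOperators x := fun u v w z ↦ by
  simp only [traceForm_apply, lie_smul, hx _ _]
  rw [← add_smul, spinOne_dotProduct_add, zero_smul, zero_add]

theorem symmetrize_cubeForm_self (x : ℂ³ →ₗ[ℂ] A) (u : ℂ³) :
    symmetrize (cubeForm x) u u u = x u ^ 3 := by
  simp only [symmetrize_apply, cubeForm_apply, pow_three']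
  module

theorem IsSpinVector.symmetrize_cubeForm_apply_apply_self (hx : IsSpinVector x) (u v : ℂ³) :
    symmetrize (cubeForm x) u v u =
      x u * x v * x u + (1 / 3 : ℂ) • ((u ⬝ᵥ u) • x v - (u ⬝ᵥ v) • x u) := by
  have hlie : ⁅x u, ⁅x u, x v⁆⁆ = (u ⬝ᵥ u) • x v - (u ⬝ᵥ v) • x u := by
    rw [hx, hx, spinOne_spinOne_self, map_sub, map_smul, map_smul]
  rw [← hlie, symmetrize_apply]
  simp only [cubeForm_apply, Ring.lie_def, mul_sub, sub_mul, mul_assoc]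
  module

theorem IsSpinVector.symmetrize_cubeForm_of_cross_eq (hx : IsSpinVector x) {u v w : ℂ³}
    (huv : u ⨯₃ v = w) (hvw : v ⨯₃ w = u) (hwu : w ⨯₃ u = v) :
    symmetrize (cubeForm x) u v w =
      x u * x v * x w + (1 / (2 * I)) • (x u ^ 2 - x v ^ 2 + x w ^ 2) := by
  have hlie {p q t : ℂ³} (h : p ⨯₃ q = t) : x q * x p = x p * x q - I • x t := by
    rw [← h, ← map_smul, ← spinOne_apply, ← hx, Ring.lie_def, sub_sub_cancel]
  have hI : 1 / (2 * I) = -(I / 2) := by rw [one_div, mul_inv, inv_I]; ring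
  have hvuw := congrArg (· * x w) (hlie huv)
  have huwv := congrArg (x u * ·) (hlie hvw)
  have hvwu := congrArg (x v * ·) (hlie hwu)
  have hwuv := congrArg (· * x v) (hlie hwu)
  have hwvu := congrArg (x w * ·) (hlie huv)
  simp only [mul_sub, sub_mul, mul_smul_comm, smul_mul_assoc, ← mul_assoc]
    at hvuw huwv hvwu hwuv hwvu
  rw [symmetrize_apply, hI]
  simp only [cubeForm_apply, sq]
  linear_combination (norm := module) (1 / 3 : ℂ) • hvuw + (1 / 2 : ℂ) • huwv - (1 / 6 : ℂ) • hvwu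
    - (1 / 3 : ℂ) • hwuv + (1 / 6 : ℂ) • hwvu

theorem isSelfAdjoint_symmetrize_cubeForm [StarRing A] [StarModule ℂ A] {u v w : ℂ³}
    (hu : IsSelfAdjoint (x u)) (hv : IsSelfAdjoint (x v)) (hw : IsSelfAdjoint (x w)) :
    IsSelfAdjoint (symmetrize (cubeForm x) u v w) := by
  have hstar : star (1 / 6 : ℂ) = 1 / 6 := by simp
  simp only [IsSelfAdjoint, symmetrize_apply, cubeForm_apply, star_smul, star_add, star_mul,
    hu.star_eq, hv.star_eq, hw.star_eq, hstar, ← mul_assoc]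
  module

theorem smul_add_smul_add_smul_eq_zero (hT : T ∈ tensorOperators x) {n u v w u' v' w' : ℂ³}
    {c₁ c₂ c₃ : ℂ} (h : T u v w = 0) (hu : spinOne n u = c₁ • u') (hv : spinOne n v = c₂ • v')
    (hw : spinOne n w = c₃ • w') : c₁ • T u' v w + c₂ • T u v' w + c₃ • T u v w' = 0 := by
  simpa only [h, lie_zero, hu, hv, hw, map_smul, LinearMap.smul_apply] using (hT n u v w).symm

theorem apply_raisingDir_raisingDir_eq_zero (hT : T ∈ tensorOperators x)
    (hsymm : T ∈ symmetricForms A) (hrrr : T e₊ e₊ e₊ = 0) (hsum : T e₊ e₊ e₋ + T e₊ e₀ e₀ = 0) :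
    T e₊ e₊ = 0 := by
  have hr := spinOne_loweringDir_raisingDir
  have ha : spinOne e₋ e₀ = (1 : ℂ) • e₋ := by rw [spinOne_loweringDir_axisDir, one_smul]
  have hrra : T e₊ e₊ e₀ = 0 := by
    have h := smul_add_smul_add_smul_eq_zero hT hrrr hr hr hr
    rw [(hsymm e₀ e₊ e₊).1, (hsymm e₊ e₀ e₊).2] at h
    linear_combination (norm := module) (-1 / 6 : ℂ) • h
  have hraa : T e₊ e₀ e₀ = 0 := by
    have h := smul_add_smul_add_smul_eq_zero hT hrra hr hr ha
    rw [(hsymm e₀ e₊ e₀).1] at h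
    linear_combination (norm := module) (1 / 5 : ℂ) • (hsum - h)
  exact eq_zero_of_raisingDir_axisDir_loweringDir hrrr hrra (by rwa [hraa, add_zero] at hsum)

/- The rotations generated by the lowering direction successively annihilate the components of
lower weight. -/
theorem eq_zero_of_raisingDir_eq_zero (hT : T ∈ tensorOperators x) (hsymm : T ∈ symmetricForms A)
    (hrrr : T e₊ e₊ e₊ = 0) (hsum : T e₊ e₊ e₋ + T e₊ e₀ e₀ = 0) : T = 0 := by
  have swap₁₂ (u v w) : T u v w = T v u w := (hsymm u v w).1
  have swap₂₃ (u v w) : T u v w = T u w v := (hsymm u v w).2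
  have hr := spinOne_loweringDir_raisingDir
  have ha : spinOne e₋ e₀ = (1 : ℂ) • e₋ := by rw [spinOne_loweringDir_axisDir, one_smul]
  have hl : spinOne e₋ e₋ = (0 : ℂ) • e₋ := by rw [spinOne_self, zero_smul]
  have hrr (w) : T e₊ e₊ w = 0 :=
    LinearMap.congr_fun (apply_raisingDir_raisingDir_eq_zero hT hsymm hrrr hsum) w
  have hraa : T e₊ e₀ e₀ = 0 := by rwa [hrr, zero_add] at hsum
  have hral : T e₊ e₀ e₋ = 0 := by
    have h := smul_add_smul_add_smul_eq_zero hT (hrr _) hr hr hl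
    rw [swap₁₂ e₀] at h
    linear_combination (norm := module) (-1 / 4 : ℂ) • h
  have haaa : T e₀ e₀ e₀ = 0 := by
    have h := smul_add_smul_add_smul_eq_zero hT hraa hr ha ha
    rw [swap₂₃ e₊ e₋] at h
    linear_combination (norm := module) (-1 / 2 : ℂ) • h + hral
  have haal : T e₀ e₀ e₋ = 0 := by
    have h := smul_add_smul_add_smul_eq_zero hT haaa ha ha ha
    rw [swap₁₂ e₋, swap₂₃ e₀ e₋] at h
    linear_combination (norm := module) (1 / 3 : ℂ) • h
  have hrll : T e₊ e₋ e₋ = 0 := by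
    have h := smul_add_smul_add_smul_eq_zero hT hral hr ha hl
    linear_combination (norm := module) h + (2 : ℂ) • haal
  have hall : T e₀ e₋ e₋ = 0 := by
    have h := smul_add_smul_add_smul_eq_zero hT haal ha ha hl
    rw [swap₁₂ e₋] at h
    linear_combination (norm := module) (1 / 2 : ℂ) • h
  have hlll : T e₋ e₋ e₋ = 0 := by
    have h := smul_add_smul_add_smul_eq_zero hT hall ha hl hl
    linear_combination (norm := module) h
  exact eq_zero_of_components_eq_zero hsymm hrrr (hrr _) (hrr _) hraa hral hrll haaa haal hall hlll

theorem lie_axisDir_apply_raisingDir (hT : T ∈ tensorOperators x) :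
    ⁅x e₀, T e₊ e₊ e₊⁆ = 3 • T e₊ e₊ e₊ := by
  rw [hT, spinOne_axisDir_raisingDir]
  module

theorem commute_raisingDir_apply_raisingDir (hT : T ∈ tensorOperators x) :
    Commute (x e₊) (T e₊ e₊ e₊) := by
  rw [commute_iff_lie_eq, hT, spinOne_self]
  simp only [map_zero, LinearMap.zero_apply, add_zero]

theorem lie_axisDir_apply_raisingDir_add (hT : T ∈ tensorOperators x) :
    ⁅x e₀, T e₊ e₊ e₋ + T e₊ e₀ e₀⁆ = 1 • (T e₊ e₊ e₋ + T e₊ e₀ e₀) := by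
  rw [lie_add, hT, hT, spinOne_axisDir_raisingDir, spinOne_axisDir_loweringDir, spinOne_self]
  simp only [map_zero, map_neg, LinearMap.zero_apply]
  module

theorem commute_raisingDir_apply_raisingDir_add (hT : T ∈ tensorOperators x)
    (hsymm : T ∈ symmetricForms A) : Commute (x e₊) (T e₊ e₊ e₋ + T e₊ e₀ e₀) := by
  rw [commute_iff_lie_eq, lie_add, hT, hT, spinOne_raisingDir_loweringDir,
    spinOne_raisingDir_axisDir, spinOne_self]
  simp only [map_zero, map_neg, map_smul, LinearMap.zero_apply, LinearMap.neg_apply]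
  rw [← (hsymm e₊ e₊ e₀).2]
  module

set_option maxSynthPendingDepth 3 in
theorem IsSpinVector.exists_eq_smul_cubeForm_add_smul_traceForm (hx : IsSpinVector x)
    (hmult : ∀ (n : ℕ) (y : A), ⁅x e₀, y⁆ = n • y → Commute (x e₊) y → ∃ c : ℂ, y = c • x e₊ ^ n)
    (hT : T ∈ tensorOperators x) (hsymm : T ∈ symmetricForms A) :
    ∃ α γ : ℂ, T = α • symmetrize (cubeForm x) + γ • symmetrize (traceForm x) := by
  have hcube := symmetrize_mem_tensorOperators hx.cubeForm_mem_tensorOperators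
  have hcube' := symmetrize_mem_symmetricForms (cubeForm x)
  have htrace := symmetrize_mem_tensorOperators hx.traceForm_mem_tensorOperators
  have htrace' := symmetrize_mem_symmetricForms (traceForm x)
  obtain ⟨α, hα⟩ := hmult 3 _ (lie_axisDir_apply_raisingDir hT)
    (commute_raisingDir_apply_raisingDir hT)
  have hS := Submodule.sub_mem _ hT ((tensorOperators x).smul_mem α hcube)
  have hS' := Submodule.sub_mem _ hsymm ((symmetricForms _).smul_mem α hcube')
  obtain ⟨β, hβ⟩ := hmult 1 _ (lie_axisDir_apply_raisingDir_add hS)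
    (commute_raisingDir_apply_raisingDir_add hS hS')
  refine ⟨α, 3 / 5 * β, sub_eq_zero.1 ?_⟩
  rw [sub_add_eq_sub_sub]
  refine eq_zero_of_raisingDir_eq_zero
    (Submodule.sub_mem _ hS ((tensorOperators x).smul_mem _ htrace))
    (Submodule.sub_mem _ hS' ((symmetricForms _).smul_mem _ htrace')) ?_ ?_
  · have hrr : e₊ ⬝ᵥ e₊ = 0 := by simp [raisingDir]
    simp only [LinearMap.sub_apply, LinearMap.smul_apply, hα, symmetrize_cubeForm_self,
      symmetrize_traceForm_self, hrr, sub_self, zero_smul, smul_zero]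
  · rw [pow_one] at hβ
    simp only [LinearMap.sub_apply, LinearMap.smul_apply] at hβ ⊢
    linear_combination (norm := module) hβ - (3 / 5 * β) • symmetrize_traceForm_raisingDir_add x

end Ring

section Irreducible

variable {H : Type*} [NormedAddCommGroup H] [InnerProductSpace ℂ H] {x : ℂ³ →ₗ[ℂ] (H →L[ℂ] H)}

theorem IsIrreducibleSet.components (hirr : IsIrreducibleSet (Set.range x)) :
    IsIrreducibleSet {x e₀, x e₊, x e₋} := by
  refine hirr.of_subset_adjoin (Set.range_subset_iff.2 fun u ↦ ?_)
  have hmem {v} (hv : x v ∈ ({x e₀, x e₊, x e₋} : Set _)) := Algebra.subset_adjoin (R := ℂ) hv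
  rw [eq_smul_raisingDir_add_smul_axisDir_add_smul_loweringDir u, map_add, map_add, map_smul,
    map_smul, map_smul]
  exact add_mem (add_mem (Subalgebra.smul_mem _ (hmem (by simp)) _)
    (Subalgebra.smul_mem _ (hmem (by simp)) _)) (Subalgebra.smul_mem _ (hmem (by simp)) _)

theorem IsSpinVector.exists_eq_smul_pow_raisingDir (hx : IsSpinVector x)
    (hirr : IsIrreducibleSet (Set.range x)) (n : ℕ) (y : H →L[ℂ] H) (hy : ⁅x e₀, y⁆ = n • y)
    (hry : Commute (x e₊) y) : ∃ c : ℂ, y = c • x e₊ ^ n :=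
  hx.isAngularMomentumTriple.exists_eq_smul_pow hirr.components hy hry

end Irreducible

end TensorOperators

theorem eq_re_smul_add_re_smul_of_isSelfAdjoint {M : Type*} [AddCommGroup M] [StarAddMonoid M]
    [Module ℂ M] [StarModule ℂ M] {m p g : M} (hm : IsSelfAdjoint m) (hp : IsSelfAdjoint p)
    (hg : IsSelfAdjoint g) {α γ : ℂ} (h : m = α • p + γ • g) :
    m = (α.re : ℂ) • p + (γ.re : ℂ) • g := by
  have hre {p : M} (hp : IsSelfAdjoint p) (α : ℂ) : (realPart (α • p) : M) = (α.re : ℂ) • p := by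
    rw [realPart_smul, hp.imaginaryPart, smul_zero, sub_zero, selfAdjoint.val_smul,
      hp.coe_realPart, Complex.coe_smul]
  rw [← hm.coe_realPart, h, map_add, AddSubgroup.coe_add, hre hp, hre hg]

section Quantization

open Complex Matrix MvPolynomial

local notation "ℂ³" => Fin 3 → ℂ

variable {s : ℝ}

theorem poissonBracket_mul_right (p q r : SpherePoly s) :
    poissonBracket s p (q * r) = poissonBracket s p q * r + q * poissonBracket s p r := by
  obtain ⟨f, rfl⟩ := Ideal.Quotient.mk_surjective p
  obtain ⟨g, rfl⟩ := Ideal.Quotient.mk_surjective q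
  obtain ⟨h, rfl⟩ := Ideal.Quotient.mk_surjective r
  refine congrArg (Ideal.Quotient.mk (sphereIdeal s))
    (a₂ := polyBracket f g * h + g * polyBracket f h) ?_
  simp only [polyBracket, Derivation.leibniz, smul_eq_mul]
  ring

theorem poissonBracket_spin_spin (i j : Fin 3) :
    poissonBracket s (spin s i) (spin s j) = ∑ k, leviCivita i j k • spin s k := by
  change toSphere s (polyBracket (.X i) (.X j)) = ∑ k, leviCivita i j k • toSphere s (.X k)
  rw [Fin.sum_univ_three, ← map_zsmul, ← map_zsmul, ← map_zsmul, ← map_add, ← map_add]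
  congr 1
  fin_cases i <;> fin_cases j <;>
    simp [polyBracket, leviCivita, pderiv_X, cross_apply]

variable {H : Type*} [NormedAddCommGroup H] [InnerProductSpace ℂ H]
  (Q : (oddPlusConst s).toSubmodule →ₗ[ℝ] (H →L[ℂ] H))

/-- The quantized spin vector, extended linearly to complex directions. -/
noncomputable def spinOperator : ℂ³ →ₗ[ℂ] (H →L[ℂ] H) :=
  Fintype.linearCombination ℂ fun i ↦ Q ⟨spin s i, spin_mem s i⟩

theorem spinOperator_single (i : Fin 3) :
    spinOperator Q (Pi.single i 1) = Q ⟨spin s i, spin_mem s i⟩ := by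
  rw [spinOperator, Fintype.linearCombination_apply_single, one_smul]

/-- The quantized cubic monomials `S_i S_j S_k`, extended linearly to complex directions. -/
noncomputable def cubicOperator : ℂ³ →ₗ[ℂ] ℂ³ →ₗ[ℂ] ℂ³ →ₗ[ℂ] (H →L[ℂ] H) :=
  Fintype.linearCombination ℂ fun i ↦ Fintype.linearCombination ℂ fun j ↦
    Fintype.linearCombination ℂ fun k ↦ Q ⟨spin s i * spin s j * spin s k, spin_mul_mem s i j k⟩

theorem cubicOperator_single (i j k : Fin 3) :
    cubicOperator Q (Pi.single i 1) (Pi.single j 1) (Pi.single k 1) =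
      Q ⟨spin s i * spin s j * spin s k, spin_mul_mem s i j k⟩ := by
  simp only [cubicOperator, Fintype.linearCombination_apply_single, one_smul]

theorem cubicOperator_mem_symmetricForms : cubicOperator Q ∈ symmetricForms (H →L[ℂ] H) :=
  mem_symmetricForms_of_single fun i j k ↦ by
    simp only [cubicOperator_single]
    exact ⟨congrArg Q (Subtype.ext (congrArg (· * _) (mul_comm ..))),
      congrArg Q (Subtype.ext (mul_right_comm ..))⟩

variable {Q} [CompleteSpace H]

theorem IsQuantization.lie_eq (hQ : IsQuantization (oddPlusConst s) Q) {p q : SpherePoly s}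
    (hp hq) : ⁅Q ⟨p, hp⟩, Q ⟨q, hq⟩⁆ =
      I • Q ⟨poissonBracket s p q, (oddPlusConst s).bracket_mem' p q hp hq⟩ := by
  rw [hQ.bracket ⟨p, hp⟩ ⟨q, hq⟩, smul_smul, mul_neg, I_mul_I, neg_neg, one_smul, Ring.lie_def]

theorem IsQuantization.isSpinVector (hQ : IsQuantization (oddPlusConst s) Q) :
    IsSpinVector (spinOperator Q) := .of_single fun i j ↦ by
  have h : (⟨poissonBracket s (spin s i) (spin s j),
      (oddPlusConst s).bracket_mem' _ _ (spin_mem s i) (spin_mem s j)⟩ :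
        (oddPlusConst s).toSubmodule) =
      ∑ k, leviCivita i j k • ⟨spin s k, spin_mem s k⟩ :=
    Subtype.ext (by simp [poissonBracket_spin_spin])
  simp only [spinOne_single, map_smul, map_sum, map_zsmul, spinOperator_single, hQ.lie_eq, h]

set_option maxSynthPendingDepth 3 in
theorem IsQuantization.cubicOperator_mem_tensorOperators (hQ : IsQuantization (oddPlusConst s) Q) :
    cubicOperator Q ∈ tensorOperators (spinOperator Q) :=
    mem_tensorOperators_of_single fun n i j k ↦ by
  have h : (⟨poissonBracket s (spin s n) (spin s i * spin s j * spin s k),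
      (oddPlusConst s).bracket_mem' _ _ (spin_mem s n)
      (spin_mul_mem s i j k)⟩ : (oddPlusConst s).toSubmodule) =
      ∑ p, leviCivita n i p • ⟨spin s p * spin s j * spin s k, spin_mul_mem s p j k⟩
      + ∑ p, leviCivita n j p • ⟨spin s i * spin s p * spin s k, spin_mul_mem s i p k⟩
      + ∑ p, leviCivita n k p • ⟨spin s i * spin s j * spin s p, spin_mul_mem s i j p⟩ :=
    Subtype.ext (by simp only [poissonBracket_spin_spin, poissonBracket_mul_right, Finset.sum_mul,
      Finset.mul_sum, add_mul, smul_mul_assoc, mul_smul_comm, Submodule.coe_add, Submodule.coe_sum,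
      Submodule.coe_smul_of_tower])
  simp only [spinOne_single, map_smul, map_sum, map_zsmul, LinearMap.smul_apply,
    LinearMap.sum_apply, spinOperator_single, hQ.lie_eq, h, cubicOperator_single, map_add, smul_add]

theorem one_mem_oddPlusConst (s : ℝ) : (1 : SpherePoly s) ∈ (oddPlusConst s).toSubmodule :=
  Submodule.mem_sup_right (Submodule.mem_span_singleton_self 1)

theorem toSphere_eq_of_totalDegree_le_one {f : Poly} (hf : f.totalDegree ≤ 1) :
    toSphere s f = ∑ i, coeff (Finsupp.single i 1) f • spin s i + coeff 0 f • 1 := by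
  conv_lhs => rw [eq_of_totalDegree_le_one hf, ← mul_one (C _), ← smul_eq_C_mul]
  simp only [map_add, map_sum, map_smul]
  rfl

theorem IsAdmissibleQuantization.isIrreducibleSet_range_spinOperator
    (hQ : IsAdmissibleQuantization (oddPlusConst s) (degreeLEOne s) (degreeLEOne_le s) Q) :
    IsIrreducibleSet (Set.range (spinOperator Q)) := by
  refine hQ.irreducible.of_subset_adjoin ?_
  rintro _ ⟨⟨_, f, hf, rfl⟩, rfl⟩
  have h : (⟨toSphere s f, degreeLEOne_le s ⟨f, hf, rfl⟩⟩ : (oddPlusConst s).toSubmodule) =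
      ∑ i, coeff (Finsupp.single i 1) f • ⟨spin s i, spin_mem s i⟩
        + coeff 0 f • ⟨1, one_mem_oddPlusConst s⟩ :=
    Subtype.ext (by simpa using
      toSphere_eq_of_totalDegree_le_one ((mem_restrictTotalDegree _ _ _).1 hf))
  simp only [h, map_add, map_sum, map_smul, hQ.one, ← Complex.coe_smul, ← spinOperator_single]
  exact add_mem (sum_mem fun i _ ↦ Subalgebra.smul_mem _
    (Algebra.subset_adjoin (Set.mem_range_self _)) _)
    (Subalgebra.smul_mem _ (one_mem _) _)

theorem IsAdmissibleQuantization.exists_eq_smul_add_smul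
    (hQ : IsAdmissibleQuantization (oddPlusConst s) (degreeLEOne s) (degreeLEOne_le s) Q) :
    ∃ a c : ℝ, ∀ i j k : Fin 3, Q ⟨spin s i * spin s j * spin s k, spin_mul_mem s i j k⟩ =
      (a : ℂ) • symmetrize (cubeForm (spinOperator Q)) (Pi.single i 1) (Pi.single j 1)
        (Pi.single k 1)
      + (c : ℂ) • symmetrize (traceForm (spinOperator Q)) (Pi.single i 1) (Pi.single j 1)
        (Pi.single k 1) := by
  obtain ⟨α, γ, h⟩ := hQ.isSpinVector.exists_eq_smul_cubeForm_add_smul_traceForm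
    (hQ.isSpinVector.exists_eq_smul_pow_raisingDir hQ.isIrreducibleSet_range_spinOperator)
    hQ.cubicOperator_mem_tensorOperators (cubicOperator_mem_symmetricForms Q)
  have he (i : Fin 3) : IsSelfAdjoint (Pi.single i 1 : ℂ³) := by
    rw [IsSelfAdjoint, ← Pi.single_star, star_one]
  have hx (i : Fin 3) : IsSelfAdjoint (spinOperator Q (Pi.single i 1)) :=
    spinOperator_single Q i ▸ hQ.selfAdjoint _
  refine ⟨α.re, γ.re, fun i j k ↦ eq_re_smul_add_re_smul_of_isSelfAdjoint (hQ.selfAdjoint _)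
    (isSelfAdjoint_symmetrize_cubeForm (hx i) (hx j) (hx k))
    (isSelfAdjoint_symmetrize_traceForm (he i) (he j) (he k) (hx i) (hx j) (hx k)) ?_⟩
  rw [← cubicOperator_single, h]
  rfl

end Quantization

end SpinSphere

open SpinSphere in
theorem proposition4 (s : ℝ) (hs : 0 < s)
    {H : Type*} [NormedAddCommGroup H] [InnerProductSpace ℂ H] [CompleteSpace H]
    (Q : (oddPlusConst s).toSubmodule →ₗ[ℝ] (H →L[ℂ] H))
    (hQ : IsAdmissibleQuantization (oddPlusConst s) (degreeLEOne s) (degreeLEOne_le s) Q) :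
    ∃ a c : ℝ,
      (∀ i : Fin 3,
        Q ⟨spin s i ^ 3, spin_pow_three_mem s i⟩
          = a • Q ⟨spin s i, spin_mem s i⟩ ^ 3 + c • Q ⟨spin s i, spin_mem s i⟩) ∧
      (∀ i l : Fin 3, i ≠ l →
        Q ⟨spin s i * spin s l * spin s i, spin_mul_mem s i l i⟩
          = a • (Q ⟨spin s i, spin_mem s i⟩ * Q ⟨spin s l, spin_mem s l⟩
              * Q ⟨spin s i, spin_mem s i⟩)
            + ((1 / 3 : ℝ) * (a + c)) • Q ⟨spin s l, spin_mem s l⟩) ∧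
      Q ⟨spin s 0 * spin s 1 * spin s 2, spin_mul_mem s 0 1 2⟩
        = a • (Q ⟨spin s 0, spin_mem s 0⟩ * Q ⟨spin s 1, spin_mem s 1⟩
            * Q ⟨spin s 2, spin_mem s 2⟩)
          + ((a : ℂ) / (2 * Complex.I)) • (Q ⟨spin s 0, spin_mem s 0⟩ ^ 2
            - Q ⟨spin s 1, spin_mem s 1⟩ ^ 2 + Q ⟨spin s 2, spin_mem s 2⟩ ^ 2) := by
  obtain ⟨a, c, h⟩ := hQ.exists_eq_smul_add_smul
  have hx := hQ.isSpinVector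
  refine ⟨a, c, fun i ↦ ?_, fun i l hil ↦ ?_, ?_⟩
  · simp only [pow_three' (spin s i), h, symmetrize_cubeForm_self, symmetrize_traceForm_self,
      single_one_dotProduct, Pi.single_eq_same, one_smul, spinOperator_single, Complex.coe_smul]
  · rw [h, hx.symmetrize_cubeForm_apply_apply_self, symmetrize_traceForm_apply_apply_self]
    simp only [single_one_dotProduct, Pi.single_eq_same, Pi.single_eq_of_ne hil,
      spinOperator_single, ← Complex.coe_smul]
    push_cast
    module
  · obtain ⟨h₀₁, h₁₂, h₂₀⟩ := cross_single
    rw [h, hx.symmetrize_cubeForm_of_cross_eq h₀₁ h₁₂ h₂₀,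
      symmetrize_traceForm_of_cross_eq _ h₀₁ h₁₂ h₂₀]
    simp only [spinOperator_single, ← Complex.coe_smul]
    module
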